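/- \textbf{Model.} Fix integers $A\ge 0$, $B\ge 1$, a finite set $\mathcal W\subset(0,\infty)$ of shadowing values with a probability mass function $p_W$, a finite nonempty set $\mathcal S\subset[0,\infty)$ of transmit powers, and costs $\xi_o,\xi_r\ge 0$. A link of length $r$ steps with transmit power $\gamma\in\mathcal S$ and shadowing $w\in\mathcal W$ has outage probability $P_{out}(r,\gamma,w)=\mathbb P\big(\gamma c(r/r_0)^{-\eta}Hw\le P_{\min}\big)$, where $c,r_0,\eta,P_{\min}>0$ and $H\ge 0$ is a random variable (fading) with a given law. The shadowing values of different links are i.i.d. with law $p_W$. Relays are placed one after the other along a line starting at a sink; a relay placed $u$ steps after the previous node costs $\gamma+\xi_oP_{out}(u,\gamma,w)+\xi_r$, where $\gamma$ is the power used by the relay and $w$ the shadowing of its link to the previous node. \emph{With backtracking} (infinite line). After placing a node, the agent measures $\underline w=(w_{A+1},\dots,w_{A+B})\in\mathcal W^B$, the shadowing to that node from the locations $A+1,\dots,A+B$ steps ahead, and then chooses $u\in\{A+1,\dots,A+B\}$ and $\gamma\in\mathcal S$. For a deterministic Markov policy $\mu=(\mu_k)_{k\ge1}$, $\mu_k=(\mu^{(1)}_k,\mu^{(2)}_k):\mathcal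 W^B\to\{A+1,\dots,A+B\}\times\mathcal S$, and i.i.d. vectors $\underline W(k)$ with i.i.d. entries of law $p_W$, let $$\lambda^*=\inf_{\mu}\ \limsup_{n\to\infty}\frac{\sum_{k=1}^n\mathbb E\big[\mu_k^{(2)}(\underline W(k))+\xi_oP_{out}\big(\mu_k^{(1)}(\underline W(k)),\mu_k^{(2)}(\underline W(k)),W_{\mu_k^{(1)}(\underline W(k))}(k)\big)+\xi_r\big]}{\sum_{k=1}^n\mathbb E\,\mu_k^{(1)}(\underline W(k))}.$$ \emph{Without backtracking.} After placing a node, the agent skips $A$ steps and then, at the successive distances $r=A+1,\dots,A+B$, measures the shadowing to the previous node and at once, from the measurements made so far, decides whether to place a relay there and with what power; at $r=A+B$ a relay must be placed. For $\theta\in(0,1)$ let $J_\theta(\mathbf 0)$ be the infimum over all such policies of the expected total cost $\mathbb E\big(\sum_{i=1}^{N+1}\Gamma_i+\xi_o\sum_{i=1}^{N+1}P^{(i,i-1)}_{out}+\xi_rN\big)$ when the line has geometric length $L$, $\mathbb P(L=\ell)=(1-\theta)^{\ell-1}\theta$ for $\ell\ge1$, independent of the shadowing. Here the source is placed at the end of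 the line, with a power chosen after its link to the previous node has been measured; $N$ is the number of relays placed before the end of the line, and $\Gamma_i$ and $P^{(i,i-1)}_{out}$ are the power and the outage probability of the link from node $i$ to node $i-1$ (the sink is node $0$, the source is node $N+1$). Let $\lambda'$ be the optimal average cost per step without backtracking on the infinite line, i.e. the infimum over all policies of $\limsup_{n\to\infty}\frac1n\mathbb E[\text{total cost of the relays placed within the first } n \text{ steps}]$. \textbf{Theorem.} The limit of $\theta J_\theta(\mathbf 0)$ as $\theta\downarrow0$ exists and equals $\lambda'$, and $$\lambda'\ \ge\ \lambda^*.$$ -/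

import Mathlib

open Filter Topology MeasureTheory

noncomputable section

/-- The data of the impromptu deployment problem. -/
structure DeploymentModel where
  /-- After a node is placed, `A` locations are skipped ... -/
  A : ℕ
  /-- ... and the next relay is placed at one of the following `B` locations. -/
  B : ℕ
  one_le_B : 1 ≤ B
  /-- The finite set of shadowing values. -/
  shadow : Finset ℝ
  shadow_pos : ∀ w ∈ shadow, 0 < w
  /-- The probability mass function of the shadowing of a link. -/
  pW : ℝ → ℝ
  pW_nonneg : ∀ w ∈ shadow, 0 ≤ pW w
  pW_sum : ∑ w ∈ shadow, pW w = 1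
  /-- The finite set of transmit power levels. -/
  powers : Finset ℝ
  powers_nonempty : powers.Nonempty
  powers_nonneg : ∀ γ ∈ powers, 0 ≤ γ
  /-- The law of the (nonnegative) fading variable `H`. -/
  fading : Measure ℝ
  fading_prob : IsProbabilityMeasure fading
  fading_nonneg : fading (Set.Iio 0) = 0
  /-- Path loss at the reference distance. -/
  c : ℝ
  c_pos : 0 < c
  /-- Reference distance. -/
  r₀ : ℝ
  r₀_pos : 0 < r₀
  /-- Path-loss exponent. -/
  η : ℝ
  η_pos : 0 < η
  /-- A link is in outage when the received power is at most `Pmin`. -/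
  Pmin : ℝ
  Pmin_pos : 0 < Pmin
  /-- Cost per unit outage probability. -/
  ξo : ℝ
  ξo_nonneg : 0 ≤ ξo
  /-- Cost of a relay. -/
  ξr : ℝ
  ξr_nonneg : 0 ≤ ξr

namespace DeploymentModel

variable (M : DeploymentModel)

/-- Outage probability of a link of length `r` (in steps), transmit power `γ` and shadowing `w`:
the probability that `γ c (r / r₀)^(-η) H w ≤ Pmin`. -/
def Pout (r : ℕ) (γ w : ℝ) : ℝ :=
  M.fading.real {h : ℝ | γ * M.c * ((r : ℝ) / M.r₀) ^ (-M.η) * h * w ≤ M.Pmin}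

/-- Power cost plus outage cost of one link. -/
def linkCost (r : ℕ) (γ w : ℝ) : ℝ := γ + M.ξo * M.Pout r γ w

/-! ### Deployment with backtracking, infinite line -/

/-- Probability of the vector `(w_{A+1}, …, w_{A+B})`; the entry of index `i` is `w_{A+1+i}`. -/
def stateProb (w : Fin M.B → M.shadow) : ℝ := ∏ i, M.pW (w i)

/-- A deterministic Markov policy with backtracking: at the `k`-th decision instant it maps the
measured vector to an action `(i, γ)`: place the relay at distance `A + 1 + i`, with power `γ`. -/
def BacktrackPolicy : Type := ℕ → (Fin M.B → M.shadow) → Fin M.B × M.powers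

/-- The placement distance `u` in `{A+1, …, A+B}` encoded by an index. -/
def placeDist (i : Fin M.B) : ℕ := M.A + 1 + i

/-- Expected cost of the `k`-th placement (the measured vectors are i.i.d. over `k`). -/
def backtrackStageCost (μ : M.BacktrackPolicy) (k : ℕ) : ℝ :=
  ∑ w, M.stateProb w *
    (M.linkCost (M.placeDist (μ k w).1) (μ k w).2 (w (μ k w).1) + M.ξr)

/-- Expected length of the `k`-th hop. -/
def backtrackStageLength (μ : M.BacktrackPolicy) (k : ℕ) : ℝ :=
  ∑ w, M.stateProb w * (M.placeDist (μ k w).1 : ℝ)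

/-- The long-run expected average cost per step of a policy with backtracking
(the sequence of ratios is bounded, so this real `limsup` is the usual one). -/
def backtrackAvgCost (μ : M.BacktrackPolicy) : ℝ :=
  limsup (fun n : ℕ =>
    (∑ k ∈ Finset.range n, M.backtrackStageCost μ k) /
      (∑ k ∈ Finset.range n, M.backtrackStageLength μ k)) atTop

/-- `λ*`: the optimal average cost per step with backtracking. -/
def optAvgBacktrack : ℝ := ⨅ μ : M.BacktrackPolicy, M.backtrackAvgCost μ

/-! ### Deployment without backtracking -/

/-- The measurements made so far, most recent first: pairs (distance to the previous node,
shadowing of the link to the previous node). -/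
abbrev History : Type := List (ℕ × M.shadow)

/-- A (deterministic, history-dependent) placement policy without backtracking. All decisions are
functions of the history, which includes the measurement at the current location. -/
structure Policy where
  /-- Place a relay here? -/
  place : M.History → Bool
  /-- Transmit power of a relay placed here. -/
  relayPower : M.History → M.powers
  /-- Transmit power of the source, if the line ends here. -/
  sourcePower : M.History → M.powers

variable {M}

/-- Total cost (power, outage, relay cost) of the relays placed while walking past locations that
are not the end of the line. The agent stands `d` steps after the previous node with history `h`;
the list holds the shadowing from each of the locations ahead to the previous node at the
time when the agent gets there. Locations at distance at most `A` are skipped (nothing is measured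
there); at distance `A + B` a relay must be placed. -/
def Policy.relayCost (π : M.Policy) : ℕ → M.History → List M.shadow → ℝ
  | _, _, [] => 0
  | d, h, w :: ws =>
    if d + 1 ≤ M.A then π.relayCost (d + 1) h ws
    else if M.A + M.B ≤ d + 1 ∨ π.place ((d + 1, w) :: h) = true then
      M.linkCost (d + 1) (π.relayPower ((d + 1, w) :: h)) w + M.ξr
        + π.relayCost 0 ((d + 1, w) :: h) ws
    else π.relayCost (d + 1) ((d + 1, w) :: h) ws

/-- Total cost `∑_{i=1}^{N+1} Γ_i + ξo ∑_{i=1}^{N+1} Pout_i + ξr N` of the deployment on a line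
that ends at the last location of the list, where the source is placed (no relay cost is
charged for the source). Otherwise as in `relayCost`. -/
def Policy.lineCost (π : M.Policy) : ℕ → M.History → List M.shadow → ℝ
  | _, _, [] => 0
  | d, h, w :: ws =>
    if ws = [] then M.linkCost (d + 1) (π.sourcePower ((d + 1, w) :: h)) w
    else if d + 1 ≤ M.A then π.lineCost (d + 1) h ws
    else if M.A + M.B ≤ d + 1 ∨ π.place ((d + 1, w) :: h) = true then
      M.linkCost (d + 1) (π.relayPower ((d + 1, w) :: h)) w + M.ξr
        + π.lineCost 0 ((d + 1, w) :: h) ws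
    else π.lineCost (d + 1) ((d + 1, w) :: h) ws

variable (M)

/-- Expectation of a function of `n` i.i.d. shadowing values. -/
def expect (n : ℕ) (f : List M.shadow → ℝ) : ℝ :=
  ∑ w : Fin n → M.shadow, (∏ i, M.pW (w i)) * f (List.ofFn w)

variable {M}

/-- Expected total cost of a policy, started at the sink, when the line length `L` is geometric:
`P(L = l + 1) = (1 - θ)^l θ` (a convergent series of nonnegative terms for `0 < θ ≤ 1`,
since the cost of a line of length `l + 1` is at most a constant times `l + 1`). -/
def Policy.expectedCost (π : M.Policy) (θ : ℝ) : ℝ :=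
  ∑' l : ℕ, (1 - θ) ^ l * θ * M.expect (l + 1) (π.lineCost 0 [])

/-- The long-run expected average cost per step of a policy without backtracking on the infinite
line (the sequence is bounded, so this real `limsup` is the usual one). -/
def Policy.avgCost (π : M.Policy) : ℝ :=
  limsup (fun n : ℕ => M.expect n (π.relayCost 0 []) / n) atTop

variable (M)

/-- `J_θ(0)`: the optimal expected total cost without backtracking, for a geometric line. -/
def optCost (θ : ℝ) : ℝ := ⨅ π : M.Policy, π.expectedCost θ

/-- `λ'`: the optimal average cost per step without backtracking. -/
def optAvgNoBacktrack : ℝ := ⨅ π : M.Policy, π.avgCost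

end DeploymentModel

end

/-!
Without backtracking, deployment is an average-cost Markov decision problem whose state is the
distance `d` from the last node: the measurements are independent of the past, and only the current
one matters for the cost of placing a relay here. Give the agent a reward `lam` per step. The
optimal cost of a single hop is then a continuous function of `lam`, nonnegative at `lam = 0` and
nonpositive when `lam` bounds the cost of every relay, so it vanishes for some `lam ≥ 0`. For this
`lam` the values `v d` of the one-hop stopping problem solve the average-cost optimality equation
(`DeploymentModel.exists_isRelativeValue`).

By induction on the number `n` of steps, the optimality equation shows that every policy has
expected cost at least `n * lam - O(1)`, and that the threshold policy built from `v` has expected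
cost at most `n * lam + O(1)`, the constants being uniform in the policy and in `n`. Hence the
optimal average cost is `lam`. The cost of a line of length `n` differs from the cost of the relays
placed within `n` steps by a bounded amount, so averaging over a geometric length of mean `1 / θ`
gives `J_θ(0) = lam / θ + O(1)`, uniformly in `θ`, and no Abelian theorem is needed.

With backtracking the agent knows the whole vector of measurements of a hop, and may run the
threshold rule on it. This yields a stationary policy whose mean cost per hop is at most `lam` times
its mean hop length (`DeploymentModel.IsRelativeValue.exists_choice`), so `λ* ≤ lam`.
-/

noncomputable section

namespace DeploymentModel

variable (M : DeploymentModel)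

/-! ### Expectations over independent shadowing values -/

/-- Expectation of a function of the vector of `n` i.i.d. shadowing values. -/
def vecExpect (n : ℕ) (f : (Fin n → M.shadow) → ℝ) : ℝ :=
  ∑ w : Fin n → M.shadow, (∏ i, M.pW (w i)) * f w

theorem pW_nonneg' (w : M.shadow) : 0 ≤ M.pW w := M.pW_nonneg w w.2

theorem sum_pW : ∑ w : M.shadow, M.pW w = 1 := by
  rw [← M.pW_sum]
  exact Finset.sum_coe_sort M.shadow M.pW

theorem sum_pW_mul_const_add (a : ℝ) (f : M.shadow → ℝ) :
    ∑ w : M.shadow, M.pW w * (a + f w) = a + ∑ w : M.shadow, M.pW w * f w := by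
  simp only [mul_add, Finset.sum_add_distrib, ← Finset.sum_mul, sum_pW, one_mul]

theorem sum_pW_mul_const (a : ℝ) : ∑ w : M.shadow, M.pW w * a = a := by
  rw [← Finset.sum_mul, sum_pW, one_mul]

theorem sum_pW_mul_mono {f g : M.shadow → ℝ} (h : ∀ w, f w ≤ g w) :
    ∑ w : M.shadow, M.pW w * f w ≤ ∑ w : M.shadow, M.pW w * g w :=
  Finset.sum_le_sum fun w _ => mul_le_mul_of_nonneg_left (h w) (M.pW_nonneg' w)

theorem vecExpect_succ (n : ℕ) (f : (Fin (n + 1) → M.shadow) → ℝ) :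
    M.vecExpect (n + 1) f =
      ∑ w : M.shadow, M.pW w * M.vecExpect n fun ws => f (Fin.cons w ws) := by
  unfold vecExpect
  rw [← (Fin.consEquiv fun _ : Fin (n + 1) => (M.shadow : Type)).sum_comp, Fintype.sum_prod_type]
  refine Finset.sum_congr rfl fun w _ => ?_
  rw [Finset.mul_sum]
  refine Finset.sum_congr rfl fun ws _ => ?_
  simp [Fin.consEquiv, Fin.prod_univ_succ, mul_assoc]

theorem vecExpect_mono {n : ℕ} {f g : (Fin n → M.shadow) → ℝ} (h : ∀ w, f w ≤ g w) :
    M.vecExpect n f ≤ M.vecExpect n g :=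
  Finset.sum_le_sum fun w _ => mul_le_mul_of_nonneg_left (h w)
    (Finset.prod_nonneg fun i _ => M.pW_nonneg' (w i))

theorem vecExpect_const (n : ℕ) (a : ℝ) : M.vecExpect n (fun _ => a) = a := by
  induction n with
  | zero => simp [vecExpect]
  | succ n ih => rw [vecExpect_succ, ih, sum_pW_mul_const]

theorem vecExpect_const_add (n : ℕ) (a : ℝ) (f : (Fin n → M.shadow) → ℝ) :
    M.vecExpect n (fun w => a + f w) = a + M.vecExpect n f := by
  conv_rhs => rw [← M.vecExpect_const n a]
  simp only [vecExpect, mul_add, Finset.sum_add_distrib]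

theorem expect_eq_vecExpect (n : ℕ) (f : List M.shadow → ℝ) :
    M.expect n f = M.vecExpect n fun w => f (List.ofFn w) := rfl

theorem expect_zero (f : List M.shadow → ℝ) : M.expect 0 f = f [] := by simp [expect]

theorem expect_succ (n : ℕ) (f : List M.shadow → ℝ) :
    M.expect (n + 1) f = ∑ w : M.shadow, M.pW w * M.expect n fun ws => f (w :: ws) := by
  simp only [expect_eq_vecExpect, vecExpect_succ, List.ofFn_cons]

theorem expect_const_add (n : ℕ) (a : ℝ) (f : List M.shadow → ℝ) :
    M.expect n (fun ws => a + f ws) = a + M.expect n f :=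
  M.vecExpect_const_add n a _

theorem expect_mono {n : ℕ} {f g : List M.shadow → ℝ} (h : ∀ ws, ws.length = n → f ws ≤ g ws) :
    M.expect n f ≤ M.expect n g :=
  M.vecExpect_mono fun _ => h _ (List.length_ofFn ..)

theorem expect_const (n : ℕ) (a : ℝ) : M.expect n (fun _ => a) = a := M.vecExpect_const n a

/-! ### Costs of a single link -/

theorem Pout_nonneg (r : ℕ) (γ w : ℝ) : 0 ≤ M.Pout r γ w := measureReal_nonneg

theorem Pout_le_one (r : ℕ) (γ w : ℝ) : M.Pout r γ w ≤ 1 :=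
  haveI := M.fading_prob
  measureReal_le_one

theorem linkCost_nonneg (r : ℕ) (γ : M.powers) (w : ℝ) : 0 ≤ M.linkCost r γ w :=
  add_nonneg (M.powers_nonneg γ γ.2) (mul_nonneg M.ξo_nonneg (M.Pout_nonneg _ _ _))

/-- A bound on the cost of any relay, uniform in its distance, power and shadowing. -/
def costBound : ℝ := ∑ γ ∈ M.powers, γ + M.ξo + M.ξr

theorem linkCost_add_le (r : ℕ) (γ : M.powers) (w : ℝ) :
    M.linkCost r γ w + M.ξr ≤ M.costBound := by
  have h₁ : (γ : ℝ) ≤ ∑ γ ∈ M.powers, γ :=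
    Finset.single_le_sum (f := fun x => x) M.powers_nonneg γ.2
  have h₂ := mul_le_of_le_one_right M.ξo_nonneg (M.Pout_le_one r γ w)
  unfold linkCost costBound
  linarith

theorem costBound_nonneg : 0 ≤ M.costBound :=
  add_nonneg (add_nonneg (Finset.sum_nonneg M.powers_nonneg) M.ξo_nonneg) M.ξr_nonneg

theorem exists_bestPower (r : ℕ) (w : ℝ) :
    ∃ γ : M.powers, ∀ γ' : M.powers, M.linkCost r γ w ≤ M.linkCost r γ' w :=
  haveI : Nonempty M.powers := M.powers_nonempty.to_subtype
  Finite.exists_min fun γ : M.powers => M.linkCost r γ w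

/-- A transmit power of least cost for a link of length `r` with shadowing `w`. -/
def bestPower (r : ℕ) (w : ℝ) : M.powers := (M.exists_bestPower r w).choose

/-- The least cost of a relay at distance `r` from the previous node, under shadowing `w`. -/
def minRelayCost (r : ℕ) (w : ℝ) : ℝ := M.linkCost r (M.bestPower r w) w + M.ξr

theorem minRelayCost_le (r : ℕ) (γ : M.powers) (w : ℝ) :
    M.minRelayCost r w ≤ M.linkCost r γ w + M.ξr :=
  add_le_add_left ((M.exists_bestPower r w).choose_spec γ) M.ξr

theorem minRelayCost_nonneg (r : ℕ) (w : ℝ) : 0 ≤ M.minRelayCost r w :=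
  add_nonneg (M.linkCost_nonneg _ _ _) M.ξr_nonneg

/-! ### The optimality equation for the average cost -/

/-- The average-cost optimality (Bellman) equation of the deployment without backtracking: `lam` is
the average cost per step, and `v d` the relative value of standing `d` steps after the last node,
normalized by `v 0 = 0`. Placing a relay leads back to the state `0`, so that it contributes only
its cost. -/
def IsRelativeValue (lam : ℝ) (v : ℕ → ℝ) : Prop :=
  v 0 = 0 ∧ ∀ d < M.A + M.B, v d + lam =
    if d + 1 ≤ M.A then v (d + 1)
    else ∑ w : M.shadow, M.pW w *
      if M.A + M.B ≤ d + 1 then M.minRelayCost (d + 1) w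
      else min (M.minRelayCost (d + 1) w) (v (d + 1))

/-- The backward recursion for the cost of one hop from distance `A + B - k` on, when each step
earns a reward `lam` and the next relay ends the problem. -/
def hopValue (lam : ℝ) : ℕ → ℝ
  | 0 => 0
  | k + 1 =>
    (if M.B ≤ k then hopValue lam k
    else ∑ w : M.shadow, M.pW w *
      if k = 0 then M.minRelayCost (M.A + M.B - k) w
      else min (M.minRelayCost (M.A + M.B - k) w) (hopValue lam k)) - lam

theorem continuous_hopValue (k : ℕ) : Continuous fun lam => M.hopValue lam k := by
  induction k with
  | zero => exact continuous_const
  | succ k ih =>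
    simp only [hopValue]
    split_ifs <;> fun_prop

theorem hopValue_zero_nonneg (k : ℕ) : 0 ≤ M.hopValue 0 k := by
  induction k with
  | zero => exact le_rfl
  | succ k ih =>
    simp only [hopValue, sub_zero]
    split_ifs with h₁ h₂
    · exact ih
    · exact Finset.sum_nonneg fun _ _ => mul_nonneg (M.pW_nonneg' _) (M.minRelayCost_nonneg _ _)
    · exact Finset.sum_nonneg fun _ _ => mul_nonneg (M.pW_nonneg' _)
        (le_min (M.minRelayCost_nonneg _ _) ih)

theorem hopValue_costBound_nonpos (k : ℕ) : M.hopValue M.costBound k ≤ 0 := by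
  induction k with
  | zero => exact le_rfl
  | succ k ih =>
    have hC := M.costBound_nonneg
    simp only [hopValue]
    split_ifs with h₁ h₂
    · linarith
    · exact sub_nonpos.2 ((M.sum_pW_mul_mono fun _ => M.linkCost_add_le _ _ _).trans_eq
        (M.sum_pW_mul_const _))
    · exact sub_nonpos.2 ((M.sum_pW_mul_mono fun _ =>
        (min_le_left _ _).trans (M.linkCost_add_le _ _ _)).trans_eq (M.sum_pW_mul_const _))

/-- The optimality equation is solvable: by the intermediate value theorem some reward per step
makes the optimal cost of a hop vanish. -/
theorem exists_isRelativeValue : ∃ lam v, 0 ≤ lam ∧ M.IsRelativeValue lam v := by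
  obtain ⟨lam, hlam, h0⟩ : (0 : ℝ) ∈ (fun lam => M.hopValue lam (M.A + M.B)) ''
      Set.Icc 0 M.costBound :=
    intermediate_value_Icc' M.costBound_nonneg (M.continuous_hopValue _).continuousOn
      ⟨M.hopValue_costBound_nonpos _, M.hopValue_zero_nonneg _⟩
  refine ⟨lam, fun d => M.hopValue lam (M.A + M.B - d), hlam.1, h0, fun d hd => ?_⟩
  obtain ⟨k, hk⟩ : ∃ k, M.A + M.B = d + 1 + k := ⟨M.A + M.B - (d + 1), by omega⟩
  have e₁ : M.A + M.B - d = k + 1 := by omega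
  have e₂ : M.A + M.B - (d + 1) = k := by omega
  have e₃ : M.A + M.B - k = d + 1 := by omega
  have e₄ : M.B ≤ k ↔ d + 1 ≤ M.A := by omega
  have e₅ : k = 0 ↔ M.A + M.B ≤ d + 1 := by omega
  simp only [e₁, e₂, e₃, e₄, e₅, hopValue, sub_add_cancel]

/-! ### Expected costs of policies without backtracking -/

variable {M}

/-- Verification, lower half: under every policy the expected cost of `n` steps is at least
`n * lam` up to a constant. -/
theorem IsRelativeValue.le_expect_relayCost {lam K : ℝ} {v : ℕ → ℝ} (hv : M.IsRelativeValue lam v)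
    (hK : ∀ d < M.A + M.B, v d ≤ K) (π : M.Policy) (n d : ℕ) (h : M.History)
    (hd : d < M.A + M.B) : n * lam + v d - K ≤ M.expect n (π.relayCost d h) := by
  have hB := M.one_le_B
  induction n generalizing d h with
  | zero =>
    have := hK d hd
    simp only [expect_zero, Policy.relayCost]
    push_cast
    linarith
  | succ n ih =>
    have hbell := hv.2 d hd
    rw [expect_succ]
    simp only [Policy.relayCost]
    push_cast
    by_cases h₁ : d + 1 ≤ M.A
    · simp only [h₁, if_true] at hbell ⊢
      rw [sum_pW_mul_const]
      have := ih (d + 1) h (by omega)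
      linarith
    · simp only [h₁, if_false] at hbell ⊢
      have e : (n + 1 : ℝ) * lam + v d - K = (n * lam - K) + (v d + lam) := by ring
      rw [e, hbell, ← sum_pW_mul_const_add]
      refine M.sum_pW_mul_mono fun w => ?_
      have hpl := ih 0 ((d + 1, w) :: h) (by omega)
      rw [hv.1] at hpl
      have hmin := M.minRelayCost_le (d + 1) (π.relayPower ((d + 1, w) :: h)) w
      by_cases h₂ : M.A + M.B ≤ d + 1
      · simp only [h₂, true_or, if_true, expect_const_add]
        linarith
      · simp only [h₂, false_or, if_false]
        by_cases h₃ : π.place ((d + 1, w) :: h) = true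
        · simp only [h₃, if_true, expect_const_add]
          linarith [min_le_left (M.minRelayCost (d + 1) w) (v (d + 1))]
        · simp only [h₃]
          have := ih (d + 1) ((d + 1, w) :: h) (by omega)
          have := min_le_right (M.minRelayCost (d + 1) w) (v (d + 1))
          simp only [Bool.false_eq_true, if_false]
          linarith

variable (M) in
/-- The stationary policy that places a relay as soon as its cost is at most the relative value `v`
of going on, with a power of least cost. The values at the empty history are never used, and the
power of the source may be arbitrary, as it changes the cost of a line by a bounded amount only. -/
def thresholdPolicy (v : ℕ → ℝ) : M.Policy where
  place
    | [] => false
    | (r, w) :: _ => decide (M.minRelayCost r w ≤ v r)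
  relayPower
    | [] => M.bestPower 0 0
    | (r, w) :: _ => M.bestPower r w
  sourcePower _ := M.bestPower 0 0

/-- Verification, upper half: the threshold policy attains `n * lam` up to a constant. -/
theorem IsRelativeValue.expect_relayCost_thresholdPolicy_le {lam K : ℝ} {v : ℕ → ℝ}
    (hv : M.IsRelativeValue lam v) (hK : ∀ d < M.A + M.B, -K ≤ v d) (n d : ℕ) (h : M.History)
    (hd : d < M.A + M.B) :
    M.expect n ((M.thresholdPolicy v).relayCost d h) ≤ n * lam + v d + K := by
  have hB := M.one_le_B
  induction n generalizing d h with
  | zero =>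
    have := hK d hd
    simp only [expect_zero, Policy.relayCost]
    push_cast
    linarith
  | succ n ih =>
    have hbell := hv.2 d hd
    rw [expect_succ]
    simp only [Policy.relayCost]
    push_cast
    by_cases h₁ : d + 1 ≤ M.A
    · simp only [h₁, if_true] at hbell ⊢
      rw [sum_pW_mul_const]
      have := ih (d + 1) h (by omega)
      linarith
    · simp only [h₁, if_false] at hbell ⊢
      have e : (n + 1 : ℝ) * lam + v d + K = (n * lam + K) + (v d + lam) := by ring
      rw [e, hbell, ← sum_pW_mul_const_add]
      refine M.sum_pW_mul_mono fun w => ?_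
      have hpl := ih 0 ((d + 1, w) :: h) (by omega)
      rw [hv.1] at hpl
      have hpow : M.linkCost (d + 1) ((M.thresholdPolicy v).relayPower ((d + 1, w) :: h)) w + M.ξr
          = M.minRelayCost (d + 1) w := rfl
      have hplace : (M.thresholdPolicy v).place ((d + 1, w) :: h) = true ↔
          M.minRelayCost (d + 1) w ≤ v (d + 1) := decide_eq_true_iff
      by_cases h₂ : M.A + M.B ≤ d + 1
      · simp only [h₂, true_or, if_true, expect_const_add, hpow]
        linarith
      · simp only [h₂, false_or, if_false, hplace, hpow]
        by_cases h₃ : M.minRelayCost (d + 1) w ≤ v (d + 1)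
        · simp only [h₃, if_true, expect_const_add, min_eq_left]
          linarith
        · have := ih (d + 1) ((d + 1, w) :: h) (by omega)
          rw [min_eq_right (not_le.1 h₃).le]
          simp only [h₃, if_false]
          linarith

theorem Policy.relayCost_nonneg (π : M.Policy) (d : ℕ) (h : M.History) (ws : List M.shadow) :
    0 ≤ π.relayCost d h ws := by
  induction ws generalizing d h with
  | nil => exact le_rfl
  | cons w ws ih =>
    simp only [Policy.relayCost]
    split_ifs
    · exact ih _ _
    · exact add_nonneg (add_nonneg (M.linkCost_nonneg _ _ _) M.ξr_nonneg) (ih _ _)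
    · exact ih _ _

theorem Policy.relayCost_le (π : M.Policy) (d : ℕ) (h : M.History) (ws : List M.shadow) :
    π.relayCost d h ws ≤ ws.length * M.costBound := by
  have hC := M.costBound_nonneg
  induction ws generalizing d h with
  | nil => simp [Policy.relayCost]
  | cons w ws ih =>
    simp only [Policy.relayCost, List.length_cons]
    push_cast
    split_ifs
    · linarith [ih (d + 1) h]
    · linarith [ih 0 ((d + 1, w) :: h),
        M.linkCost_add_le (d + 1) (π.relayPower ((d + 1, w) :: h)) w]
    · linarith [ih (d + 1) ((d + 1, w) :: h)]

/-- Ending the line with the source instead of walking on changes the cost only at the last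
location. -/
theorem Policy.abs_lineCost_sub_relayCost_le (π : M.Policy) (d : ℕ) (h : M.History)
    (ws : List M.shadow) : |π.lineCost d h ws - π.relayCost d h ws| ≤ M.costBound := by
  have hC := M.costBound_nonneg
  induction ws generalizing d h with
  | nil => simpa [Policy.relayCost, Policy.lineCost] using hC
  | cons w ws ih =>
    by_cases hws : ws = []
    · subst hws
      have h₁ := M.linkCost_nonneg (d + 1) (π.sourcePower ((d + 1, w) :: h)) w
      have h₂ := M.linkCost_add_le (d + 1) (π.sourcePower ((d + 1, w) :: h)) w
      have h₃ := π.relayCost_nonneg d h [w]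
      have h₄ := π.relayCost_le d h [w]
      have h₅ := M.ξr_nonneg
      simp only [List.length_singleton, Nat.cast_one, one_mul] at h₄
      simp only [Policy.lineCost, if_true]
      rw [abs_le]
      constructor <;> linarith
    · simp only [Policy.lineCost, Policy.relayCost, hws, if_false]
      split_ifs
      · exact ih _ _
      · rw [add_sub_add_left_eq_sub]
        exact ih _ _
      · exact ih _ _

theorem Policy.expect_lineCost_le (π : M.Policy) (n d : ℕ) (h : M.History) :
    M.expect n (π.lineCost d h) ≤ M.costBound + M.expect n (π.relayCost d h) := by
  rw [← expect_const_add]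
  exact M.expect_mono fun ws _ => by
    linarith [(abs_le.1 (π.abs_lineCost_sub_relayCost_le d h ws)).2]

theorem Policy.le_expect_lineCost (π : M.Policy) (n d : ℕ) (h : M.History) :
    -M.costBound + M.expect n (π.relayCost d h) ≤ M.expect n (π.lineCost d h) := by
  rw [← expect_const_add]
  exact M.expect_mono fun ws _ => by
    linarith [(abs_le.1 (π.abs_lineCost_sub_relayCost_le d h ws)).1]

theorem Policy.expect_relayCost_nonneg (π : M.Policy) (n d : ℕ) (h : M.History) :
    0 ≤ M.expect n (π.relayCost d h) :=
  (M.expect_const n 0).ge.trans (M.expect_mono fun ws _ => π.relayCost_nonneg d h ws)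

theorem Policy.expect_relayCost_le (π : M.Policy) (n d : ℕ) (h : M.History) :
    M.expect n (π.relayCost d h) ≤ n * M.costBound :=
  (M.expect_mono fun ws hws => by simpa [hws] using π.relayCost_le d h ws).trans_eq
    (M.expect_const n _)

/-! ### Averaging over a geometric length and over an infinite line -/

theorem hasSum_geometric_affine {θ : ℝ} (h0 : 0 < θ) (h1 : θ < 1) (a b : ℝ) :
    HasSum (fun l : ℕ => (1 - θ) ^ l * θ * ((l + 1 : ℕ) * a + b)) (a / θ + b) := by
  have hlt : ‖1 - θ‖ < 1 := by
    rw [Real.norm_eq_abs, abs_lt]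
    constructor <;> linarith
  have e₁ := (hasSum_coe_mul_geometric_of_norm_lt_one hlt).mul_left (θ * a)
  have e₂ := (hasSum_geometric_of_norm_lt_one hlt).mul_left (θ * (a + b))
  have hval : a / θ + b =
      θ * a * ((1 - θ) / (1 - (1 - θ)) ^ 2) + θ * (a + b) * (1 - (1 - θ))⁻¹ := by
    have := h0.ne'
    rw [sub_sub_cancel]
    field_simp
    ring
  rw [hval]
  refine (congrArg (HasSum · _) (funext fun l => ?_)).mpr (e₁.add e₂)
  push_cast
  ring

theorem Policy.hasSum_expectedCost (π : M.Policy) {θ : ℝ} (h0 : 0 < θ) (h1 : θ < 1) :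
    HasSum (fun l : ℕ => (1 - θ) ^ l * θ * M.expect (l + 1) (π.lineCost 0 []))
      (π.expectedCost θ) := by
  refine Summable.hasSum (Summable.of_norm_bounded
    (hasSum_geometric_affine h0 h1 M.costBound M.costBound).summable fun l => ?_)
  have hp : 0 ≤ (1 - θ) ^ l * θ := mul_nonneg (pow_nonneg (by linarith) _) h0.le
  rw [norm_mul, Real.norm_of_nonneg hp, Real.norm_eq_abs]
  refine mul_le_mul_of_nonneg_left (abs_le.2 ⟨?_, ?_⟩) hp
  · have := π.le_expect_lineCost (l + 1) 0 []
    have := π.expect_relayCost_nonneg (l + 1) 0 []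
    have : 0 ≤ ((l + 1 : ℕ) : ℝ) * M.costBound := mul_nonneg (Nat.cast_nonneg _) M.costBound_nonneg
    linarith
  · have := π.expect_lineCost_le (l + 1) 0 []
    have := π.expect_relayCost_le (l + 1) 0 []
    linarith

theorem exists_abs_le (v : ℕ → ℝ) (N : ℕ) : ∃ K, ∀ d < N, |v d| ≤ K :=
  ⟨∑ d ∈ Finset.range N, |v d|, fun _ hd =>
    Finset.single_le_sum (f := fun d => |v d|) (fun _ _ => abs_nonneg _) (Finset.mem_range.2 hd)⟩

instance : Nonempty M.Policy := ⟨M.thresholdPolicy 0⟩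

theorem IsRelativeValue.tendsto_optCost {lam : ℝ} {v : ℕ → ℝ} (hv : M.IsRelativeValue lam v) :
    Tendsto (fun θ : ℝ => θ * M.optCost θ) (𝓝[>] 0) (𝓝 lam) := by
  have hB := M.one_le_B
  obtain ⟨K, hK⟩ := exists_abs_le v (M.A + M.B)
  have lower : ∀ (π : M.Policy) (θ : ℝ), 0 < θ → θ < 1 →
      lam / θ + -(K + M.costBound) ≤ π.expectedCost θ := by
    intro π θ h0 h1
    refine hasSum_le (fun l => mul_le_mul_of_nonneg_left ?_
      (mul_nonneg (pow_nonneg (by linarith) _) h0.le))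
      (hasSum_geometric_affine h0 h1 lam (-(K + M.costBound))) (π.hasSum_expectedCost h0 h1)
    have := hv.le_expect_relayCost (fun d hd => (abs_le.1 (hK d hd)).2) π (l + 1) 0 [] (by omega)
    rw [hv.1] at this
    linarith [π.le_expect_lineCost (l + 1) 0 []]
  have upper : ∀ θ : ℝ, 0 < θ → θ < 1 →
      (M.thresholdPolicy v).expectedCost θ ≤ lam / θ + (K + M.costBound) := by
    intro θ h0 h1
    refine hasSum_le (fun l => mul_le_mul_of_nonneg_left ?_
      (mul_nonneg (pow_nonneg (by linarith) _) h0.le))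
      ((M.thresholdPolicy v).hasSum_expectedCost h0 h1)
      (hasSum_geometric_affine h0 h1 lam (K + M.costBound))
    have := hv.expect_relayCost_thresholdPolicy_le (fun d hd => (abs_le.1 (hK d hd)).1) (l + 1) 0 []
      (by omega)
    rw [hv.1] at this
    linarith [(M.thresholdPolicy v).expect_lineCost_le (l + 1) 0 []]
  have hlim : ∀ c : ℝ, Tendsto (fun θ : ℝ => lam + θ * c) (𝓝[>] 0) (𝓝 lam) := fun c => by
    have : Continuous fun θ : ℝ => lam + θ * c := by fun_prop
    simpa using (this.tendsto 0).mono_left nhdsWithin_le_nhds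
  have hmem : ∀ᶠ θ : ℝ in 𝓝[>] 0, 0 < θ ∧ θ < 1 := Ioo_mem_nhdsGT one_pos
  refine tendsto_of_tendsto_of_tendsto_of_le_of_le' (hlim (-(K + M.costBound)))
    (hlim (K + M.costBound)) (hmem.mono fun θ hθ => ?_) (hmem.mono fun θ hθ => ?_)
  · have h : lam / θ + -(K + M.costBound) ≤ M.optCost θ := le_ciInf fun π => lower π θ hθ.1 hθ.2
    have := mul_le_mul_of_nonneg_left h hθ.1.le
    rwa [mul_add, mul_div_cancel₀ _ hθ.1.ne'] at this
  · have h : M.optCost θ ≤ lam / θ + (K + M.costBound) :=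
      (ciInf_le ⟨_, Set.forall_mem_range.2 fun π => lower π θ hθ.1 hθ.2⟩ _).trans
        (upper θ hθ.1 hθ.2)
    have := mul_le_mul_of_nonneg_left h hθ.1.le
    rwa [mul_add, mul_div_cancel₀ _ hθ.1.ne'] at this

theorem IsRelativeValue.optAvgNoBacktrack_eq {lam : ℝ} {v : ℕ → ℝ}
    (hv : M.IsRelativeValue lam v) : M.optAvgNoBacktrack = lam := by
  have hB := M.one_le_B
  obtain ⟨K, hK⟩ := exists_abs_le v (M.A + M.B)
  have hlim : ∀ c : ℝ, Tendsto (fun n : ℕ => lam + c / n) atTop (𝓝 lam) := fun c => by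
    simpa using (tendsto_const_div_atTop_nhds_zero_nat c).const_add lam
  have ev : ∀ᶠ n : ℕ in atTop, (0 : ℝ) < n := by
    filter_upwards [eventually_gt_atTop 0] with n hn using Nat.cast_pos.2 hn
  have lower : ∀ π : M.Policy, lam ≤ π.avgCost := by
    intro π
    have hbdd : IsBoundedUnder (· ≤ ·) atTop
        fun n : ℕ => M.expect n (π.relayCost 0 []) / n := by
      refine isBoundedUnder_of_eventually_le (a := M.costBound) (ev.mono fun n hn => ?_)
      rw [div_le_iff₀ hn, mul_comm]
      exact π.expect_relayCost_le n 0 []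
    rw [← (hlim (-K)).limsup_eq]
    refine limsup_le_limsup (ev.mono fun n hn => ?_) (hlim (-K)).isCoboundedUnder_le hbdd
    have := hv.le_expect_relayCost (fun d hd => (abs_le.1 (hK d hd)).2) π n 0 [] (by omega)
    rw [hv.1] at this
    rw [le_div_iff₀ hn, add_mul, div_mul_cancel₀ _ hn.ne']
    linarith
  refine le_antisymm ?_ (le_ciInf lower)
  refine (ciInf_le ⟨_, Set.forall_mem_range.2 lower⟩ (M.thresholdPolicy v)).trans ?_
  rw [Policy.avgCost, ← (hlim K).limsup_eq]
  refine limsup_le_limsup (ev.mono fun n hn => ?_) ?_ (hlim K).isBoundedUnder_le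
  · have := hv.expect_relayCost_thresholdPolicy_le (fun d hd => (abs_le.1 (hK d hd)).1) n 0 []
      (by omega)
    rw [hv.1] at this
    rw [div_le_iff₀ hn, add_mul, div_mul_cancel₀ _ hn.ne']
    linarith
  · refine IsBoundedUnder.isCoboundedUnder_le (isBoundedUnder_of_eventually_ge (a := 0)
      (Eventually.of_forall fun n => ?_))
    exact div_nonneg (Policy.expect_relayCost_nonneg _ n 0 []) (Nat.cast_nonneg n)

/-! ### Comparison with backtracking -/

/-- The threshold rule, run on a vector of measurements that is known in advance, is a choice of
location and power; starting at distance `D`, with all of the distances `D + 1, …, A + B` still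
available, its mean cost with reward `lam` per step is at most the relative value of `D`. -/
theorem IsRelativeValue.exists_choice {lam : ℝ} {v : ℕ → ℝ} (hv : M.IsRelativeValue lam v)
    (m D : ℕ) (hm : 1 ≤ m) (hA : M.A ≤ D) (hD : D + m = M.A + M.B) :
    ∃ s : (Fin m → M.shadow) → Fin m × M.powers,
      M.vecExpect m (fun w => M.linkCost (D + 1 + (s w).1) (s w).2 (w (s w).1) + M.ξr -
        lam * (1 + (s w).1 : ℝ)) ≤ v D := by
  induction m, hm using Nat.le_induction generalizing D with
  | base =>
    refine ⟨fun w => (0, M.bestPower (D + 1) (w 0)), ?_⟩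
    have hbell := hv.2 D (by omega)
    have h₁ : ¬D + 1 ≤ M.A := by omega
    have h₂ : M.A + M.B ≤ D + 1 := by omega
    simp only [h₁, h₂, if_true, if_false] at hbell
    rw [← eq_sub_iff_add_eq] at hbell
    rw [hbell, vecExpect_succ]
    have : ∀ a : ℝ, a - lam = -lam + a := fun a => by ring
    rw [this, ← sum_pW_mul_const_add]
    refine M.sum_pW_mul_mono fun w => ?_
    simp [vecExpect, minRelayCost]
  | succ m hm ih =>
    obtain ⟨s, hs⟩ := ih (D + 1) (by omega) (by omega)
    refine ⟨fun w => if M.minRelayCost (D + 1) (w 0) ≤ v (D + 1)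
      then (0, M.bestPower (D + 1) (w 0)) else ((s (Fin.tail w)).1.succ, (s (Fin.tail w)).2), ?_⟩
    have hbell := hv.2 D (by omega)
    have h₁ : ¬D + 1 ≤ M.A := by omega
    have h₂ : ¬M.A + M.B ≤ D + 1 := by omega
    simp only [h₁, h₂, if_false] at hbell
    rw [← eq_sub_iff_add_eq] at hbell
    have : ∀ a : ℝ, a - lam = -lam + a := fun a => by ring
    rw [hbell, vecExpect_succ, this, ← sum_pW_mul_const_add]
    refine M.sum_pW_mul_mono fun w => ?_
    by_cases h₃ : M.minRelayCost (D + 1) w ≤ v (D + 1)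
    · simp only [Fin.cons_zero, h₃, if_true, min_eq_left, vecExpect_const]
      simp [minRelayCost]
    · rw [min_eq_right (not_le.1 h₃).le]
      simp only [Fin.cons_zero, h₃, if_false, Fin.tail_cons, Fin.cons_succ]
      refine le_trans (le_of_eq ?_) (add_le_add_right hs (-lam))
      rw [← vecExpect_const_add]
      refine congrArg (M.vecExpect m) (funext fun ws => ?_)
      have e : D + 1 + ((s ws).1.succ : ℕ) = D + 1 + 1 + ((s ws).1 : ℕ) := by
        rw [Fin.val_succ]
        ring
      rw [e, Fin.val_succ]
      push_cast
      ring

/-- Nothing is decided at the skipped locations, which only cost `lam` each. -/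
theorem IsRelativeValue.apply_of_le {lam : ℝ} {v : ℕ → ℝ} (hv : M.IsRelativeValue lam v) {d : ℕ}
    (hd : d ≤ M.A) : v d = d * lam := by
  have hB := M.one_le_B
  induction d with
  | zero => simp [hv.1]
  | succ d ih =>
    have h := hv.2 d (by omega)
    rw [if_pos hd, ih (by omega)] at h
    rw [← h]
    push_cast
    ring

theorem IsRelativeValue.optAvgBacktrack_le {lam : ℝ} {v : ℕ → ℝ} (hv : M.IsRelativeValue lam v)
    (hlam : 0 ≤ lam) : M.optAvgBacktrack ≤ lam := by
  obtain ⟨s, hs⟩ := hv.exists_choice M.B M.A M.one_le_B le_rfl rfl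
  rw [hv.apply_of_le le_rfl] at hs
  have hprob : ∀ w, 0 ≤ M.stateProb w := fun w => Finset.prod_nonneg fun i _ => M.pW_nonneg' (w i)
  have hlen : ∀ (μ : M.BacktrackPolicy) k, 0 ≤ M.backtrackStageLength μ k := fun μ k =>
    Finset.sum_nonneg fun w _ => mul_nonneg (hprob w) (Nat.cast_nonneg _)
  have hcost : ∀ (μ : M.BacktrackPolicy) k, 0 ≤ M.backtrackStageCost μ k := fun μ k =>
    Finset.sum_nonneg fun w _ => mul_nonneg (hprob w)
      (add_nonneg (M.linkCost_nonneg _ _ _) M.ξr_nonneg)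
  have hnonneg : ∀ (μ : M.BacktrackPolicy) (n : ℕ), 0 ≤
      (∑ k ∈ Finset.range n, M.backtrackStageCost μ k) /
        ∑ k ∈ Finset.range n, M.backtrackStageLength μ k := fun μ n =>
    div_nonneg (Finset.sum_nonneg fun k _ => hcost μ k) (Finset.sum_nonneg fun k _ => hlen μ k)
  -- A real `limsup` of nonnegative terms is nonnegative, whether or not the terms are bounded.
  have hbdd : BddBelow (Set.range fun μ : M.BacktrackPolicy => M.backtrackAvgCost μ) := by
    refine ⟨0, Set.forall_mem_range.2 fun μ => ?_⟩
    rw [backtrackAvgCost, limsup_eq]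
    refine Real.sInf_nonneg fun a ha => ?_
    obtain ⟨n, hn⟩ := ha.exists
    exact (hnonneg μ n).trans hn
  have hstage : ∀ k, M.backtrackStageCost (fun _ => s) k ≤
      lam * M.backtrackStageLength (fun _ => s) k := by
    intro k
    have e : M.vecExpect M.B (fun w => M.linkCost (M.A + 1 + (s w).1) (s w).2 (w (s w).1) + M.ξr -
        lam * (1 + (s w).1 : ℝ)) = M.A * lam + (M.backtrackStageCost (fun _ => s) k -
          lam * M.backtrackStageLength (fun _ => s) k) := by
      simp only [backtrackStageCost, backtrackStageLength, Finset.mul_sum,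
        ← Finset.sum_sub_distrib, stateProb]
      have := M.vecExpect_const_add M.B (M.A * lam) fun w =>
        M.linkCost (M.placeDist (s w).1) (s w).2 (w (s w).1) + M.ξr -
          lam * (M.placeDist (s w).1 : ℝ)
      refine Eq.trans (congrArg (M.vecExpect M.B) (funext fun w => ?_)) (this.trans ?_)
      · simp only [placeDist]
        push_cast
        ring
      · refine congrArg _ (Finset.sum_congr rfl fun w _ => ?_)
        ring
    rw [e] at hs
    linarith
  refine (ciInf_le hbdd (fun _ => s)).trans ?_
  refine limsup_le_of_le (IsBoundedUnder.isCoboundedUnder_le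
    (isBoundedUnder_of_eventually_ge (a := 0) (Eventually.of_forall (hnonneg fun _ => s))))
    (Eventually.of_forall fun n => ?_)
  refine div_le_of_le_mul₀ (Finset.sum_nonneg fun k _ => hlen _ k) hlam ?_
  rw [Finset.mul_sum]
  exact Finset.sum_le_sum fun k _ => hstage k

end DeploymentModel

end

/-- `θ J_θ(0)` converges, as `θ ↓ 0`, to the optimal average cost per step without backtracking
`λ'`, and `λ' ≥ λ*`, the optimal average cost per step with backtracking. -/
theorem mainTheorem5 (M : DeploymentModel) :
    Tendsto (fun θ : ℝ => θ * M.optCost θ) (𝓝[>] 0) (𝓝 M.optAvgNoBacktrack) ∧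
      M.optAvgNoBacktrack ≥ M.optAvgBacktrack := by
  obtain ⟨lam, v, hlam, hv⟩ := M.exists_isRelativeValue
  rw [hv.optAvgNoBacktrack_eq]
  exact ⟨hv.tendsto_optCost, hv.optAvgBacktrack_le hlam⟩
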